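/- Let $q=2^e$ be the order of a finite field and consider $\mathrm{PG}(3,q)$, with points and lines the subspaces of rank $1$ and $2$ of $\mathrm{GF}(q)^4$. Let $S$ be a Singer cycle of $\mathrm{PG}(3,q)$, that is, a cyclic collineation group acting regularly on the points. Let $\mathcal S$ be a regular line-spread of $\mathrm{PG}(3,q)$ (a partition of the points into lines that contains the regulus through any three of its lines) which is stabilised by $S$, and let $S_2$ be the subgroup of $S$ of order $q^2+1$. Let $\mathcal O$ be an elliptic quadric, i.e. the image under a collineation of the point set $X_0X_1+X_2^2+bX_2X_3+cX_3^2=0$ with $\xi^2+b\xi+c$ irreducible over $\mathrm{GF}(q)$, such that 1. every line of $\mathcal S$ is tangent to $\mathcal O$ (meets $\mathcal O$ in exactly one point), and 2. $S_2$ acts regularly on $\mathcal O$. Then for every point $P$ of $\mathcal O$ there are exactly $q+1$ lines through $P$ tangent to $\mathcal O$, and they form a starter set for the lines of $\mathrm{PG}(3,q)$ under $S$: they lie in pairwise distinct $S$-orbits, and every line of $\mathrm{PG}(3,q)$ is the image under an element of $S$ of one of them. -/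

import Mathlib

/-! `PG(V, F)` is the projective space whose elements are the `F`-subspaces of `V`.
Points, lines, ... are the subspaces of rank `1`, `2`, ..., incidence is inclusion, and a
collineation acts on the lattice of all subspaces. -/

namespace ProjGeom

section General

variable {F V : Type*} [Field F] [AddCommGroup V] [Module F V]

/-- A point of `PG(V, F)`: a subspace of rank `1`. -/
def IsPoint (X : Submodule F V) : Prop := Module.finrank F X = 1

/-- A line of `PG(V, F)`: a subspace of rank `2`. -/
def IsLine (X : Submodule F V) : Prop := Module.finrank F X = 2

/-- `g` is the collineation of `PG(V, F)` induced by some non-singular semilinear map `A` of `V`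
with companion automorphism `μ` of `F`. -/
def IsCollineation (g : Submodule F V ≃o Submodule F V) : Prop :=
  ∃ (μ : F ≃+* F) (A : V ≃+ V), (∀ (a : F) (v : V), A (a • v) = μ a • A v) ∧
    ∀ X : Submodule F V, (g X : Set V) = A '' (X : Set V)

/-- A group `S` acts regularly on the set `O`: it maps `O` into itself and, for all `P, Q ∈ O`,
there is exactly one element of `S` mapping `P` to `Q`. -/
def ActsRegularlyOn (S : Subgroup (Submodule F V ≃o Submodule F V)) (O : Set (Submodule F V)) :
    Prop :=
  (∀ g ∈ S, ∀ P ∈ O, g P ∈ O) ∧ ∀ P ∈ O, ∀ Q ∈ O, ∃! g, g ∈ S ∧ g P = Q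

/-- A Singer cycle: a cyclic collineation group acting regularly on the points. -/
def IsSingerCycle (S : Subgroup (Submodule F V ≃o Submodule F V)) : Prop :=
  (∀ g ∈ S, IsCollineation g) ∧ IsCyclic S ∧ ActsRegularlyOn S {P | IsPoint P}

/-- A line-spread: a family of mutually disjoint lines such that every point lies on exactly one
of them. -/
def IsLineSpread (𝓢 : Set (Submodule F V)) : Prop :=
  (∀ l ∈ 𝓢, IsLine l) ∧ 𝓢.Pairwise Disjoint ∧ ∀ P, IsPoint P → ∃! l, l ∈ 𝓢 ∧ P ≤ l

/-- A regulus of lines: `q + 1` mutually disjoint lines such that each line meeting three of them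
meets all of them, where `q` is the order of `F`. -/
def IsRegulus (R : Set (Submodule F V)) : Prop :=
  R.ncard = Nat.card F + 1 ∧ (∀ l ∈ R, IsLine l) ∧ R.Pairwise Disjoint ∧
    ∀ m, IsLine m →
      (∃ A ∈ R, ∃ B ∈ R, ∃ C ∈ R, A ≠ B ∧ A ≠ C ∧ B ≠ C ∧
        m ⊓ A ≠ ⊥ ∧ m ⊓ B ≠ ⊥ ∧ m ⊓ C ≠ ⊥) →
      ∀ D ∈ R, m ⊓ D ≠ ⊥

/-- A line-spread is regular if it contains the regulus through any three of its elements. -/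
def IsRegularLineSpread (𝓢 : Set (Submodule F V)) : Prop :=
  IsLineSpread 𝓢 ∧ ∀ A ∈ 𝓢, ∀ B ∈ 𝓢, ∀ C ∈ 𝓢, A ≠ B → A ≠ C → B ≠ C →
    ∀ R, IsRegulus R → A ∈ R → B ∈ R → C ∈ R → R ⊆ 𝓢

/-- The group `S` stabilises the family `𝓢`. -/
def Stabilises (S : Subgroup (Submodule F V ≃o Submodule F V)) (𝓢 : Set (Submodule F V)) :
    Prop :=
  ∀ g ∈ S, ∀ l ∈ 𝓢, g l ∈ 𝓢

/-- A line is tangent to a set `O` of points if it meets `O` in exactly one point. -/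
def IsTangentLine (O : Set (Submodule F V)) (l : Submodule F V) : Prop :=
  IsLine l ∧ ∃! P, P ∈ O ∧ P ≤ l

/-- `T` is a starter set, based at the point `P`, for the points and lines of `PG(V, F)` under the
group `S`: its elements are lines through `P`, lying in pairwise distinct `S`-orbits, and every
line is the image under `S` of an element of `T`. -/
def IsStarterSet (S : Subgroup (Submodule F V ≃o Submodule F V)) (P : Submodule F V)
    (T : Set (Submodule F V)) : Prop :=
  (∀ l ∈ T, IsLine l ∧ P ≤ l) ∧
  (∀ l ∈ T, ∀ m ∈ T, l ≠ m → ∀ g ∈ S, g l ≠ m) ∧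
  ∀ l, IsLine l → ∃ m ∈ T, ∃ g ∈ S, g m = l

end General

section Quadric

variable {F : Type*} [Field F]

/-- The points of `PG(3, q)` with `X₀X₁ + X₂² + b X₂X₃ + c X₃² = 0`. -/
def standardQuadric (b c : F) : Set (Submodule F (Fin 4 → F)) :=
  {P | IsPoint P ∧ ∀ x ∈ P, x 0 * x 1 + x 2 ^ 2 + b * x 2 * x 3 + c * x 3 ^ 2 = 0}

/-- An elliptic quadric of `PG(3, q)`: a set of points mapped by some collineation onto the
standard quadric with `ξ² + bξ + c` irreducible over `F`. -/
def IsEllipticQuadric (O : Set (Submodule F (Fin 4 → F))) : Prop :=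
  ∃ b c : F, Irreducible (Polynomial.X ^ 2 + Polynomial.C b * Polynomial.X + Polynomial.C c) ∧
    ∃ τ : Submodule F (Fin 4 → F) ≃o Submodule F (Fin 4 → F),
      IsCollineation τ ∧ τ '' O = standardQuadric b c

end Quadric

end ProjGeom

/-! In characteristic 2 the polar form `B` of the quadric is alternating and non-degenerate, and the
tangent lines are exactly the lines totally isotropic for `B` (`isTangentLine_iff`). The tangents at
`p` are thus the lines through `p` in the rank 3 space `p^⊥`, which gives the count.

Each spread line contains one point of `O`, and `S₂` is transitive on `O`; hence every element of
`S` is one of `S₂`, which preserves tangency, times one that fixes every spread line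
(`exists_mul_fixing_spread`). It remains to study a map `A` inducing a nontrivial element of the
second kind. It fixes no point, so `v` and `A v` span the spread line through `v`. As that line is
isotropic, `B v (A v) = 0`, and polarising makes `A` self-adjoint.

Distinct orbits (`mem_spread_of_isotropic_image`): `A` is linear and, on a line `⟨x, y⟩` off the
spread, satisfies `A² = c + d A` with `d ≠ 0`. If the line and its image are both isotropic,
self-adjointness gives `B (A x) y = 0`, so `x` is orthogonal to the whole space.

Every line occurs (`exists_isotropic_image`): for `C = a + b A` the cross terms of `B (C x) (C y)`
cancel, leaving `a² B(x, y) + b² B(Ax, Ay)`. Square roots exist, so this vanishes for some `(a, b) ≠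
0`, and transitivity on points supplies an element of `S` acting like this `C`. -/

namespace ProjGeom

/-! ### Spans, lines, and the pencil of lines through a point of a plane -/

section Lines

variable {F V : Type*} [Field F] [AddCommGroup V] [Module F V]

theorem isPoint_span {v : V} (hv : v ≠ 0) : IsPoint (Submodule.span F {v}) :=
  finrank_span_singleton hv

theorem IsPoint.exists_eq_span {P : Submodule F V} (h : IsPoint P) :
    ∃ v : V, v ≠ 0 ∧ P = Submodule.span F {v} := by
  obtain ⟨v, hv, hw⟩ := finrank_eq_one_iff'.1 h
  refine ⟨v, fun h0 => hv (Subtype.ext h0), le_antisymm (fun w hwP => ?_) ?_⟩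
  · obtain ⟨c, hc⟩ := hw ⟨w, hwP⟩
    exact Submodule.mem_span_singleton.2 ⟨c, congrArg Subtype.val hc⟩
  · exact (Submodule.span_singleton_le_iff_mem _ _).2 v.2

theorem span_singleton_eq_of_mem {x y : V} (hx : x ≠ 0) (h : x ∈ Submodule.span F {y}) :
    Submodule.span F {x} = Submodule.span F {y} := by
  obtain ⟨a, rfl⟩ := Submodule.mem_span_singleton.1 h
  have ha : a ≠ 0 := by rintro rfl; simp at hx
  exact Submodule.span_singleton_smul_eq (IsUnit.mk0 a ha) y

theorem finrank_span_pair {x y : V} (hx : x ≠ 0) (hy : y ∉ Submodule.span F {x}) :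
    Module.finrank F (Submodule.span F {x, y}) = 2 := by
  have hli : LinearIndependent F ![x, y] :=
    (LinearIndependent.pair_iff' hx).2 fun a ha => hy (Submodule.mem_span_singleton.2 ⟨a, ha⟩)
  have := finrank_span_eq_card hli
  rwa [Matrix.range_cons_cons_empty, Fintype.card_fin] at this

theorem eq_zero_of_smul_add_smul_eq_zero {x y : V} (hx : x ≠ 0)
    (hy : y ∉ Submodule.span F {x}) {a b : F} (h : a • x + b • y = 0) : a = 0 ∧ b = 0 := by
  have hb : b = 0 := by
    by_contra hb
    refine hy (Submodule.mem_span_singleton.2 ⟨-(b⁻¹ * a), ?_⟩)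
    rw [neg_smul, mul_smul, eq_neg_of_add_eq_zero_left h, smul_neg, neg_neg, smul_smul,
      inv_mul_cancel₀ hb, one_smul]
  subst hb
  rw [zero_smul, add_zero] at h
  exact ⟨(smul_eq_zero.1 h).resolve_right hx, rfl⟩

variable [FiniteDimensional F V]

theorem IsLine.eq_span_pair {l : Submodule F V} (hl : IsLine l) {x y : V} (hx : x ≠ 0)
    (hxl : x ∈ l) (hyl : y ∈ l) (hy : y ∉ Submodule.span F {x}) :
    l = Submodule.span F {x, y} := by
  refine (Submodule.eq_of_le_of_finrank_le ?_ ?_).symm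
  · rw [Submodule.span_le]
    rintro z (rfl | rfl) <;> assumption
  · rw [finrank_span_pair hx hy]
    exact hl.le

omit [FiniteDimensional F V] in
theorem IsLine.exists_notMem_span {l : Submodule F V} (hl : IsLine l) (x : V) :
    ∃ y ∈ l, y ∉ Submodule.span F {x} := by
  by_contra! h
  have h1 := Submodule.finrank_mono (show l ≤ Submodule.span F {x} from h)
  have h2 := finrank_span_le_card (R := F) ({x} : Set V)
  rw [Set.toFinset_singleton, Finset.card_singleton] at h2
  have h3 : Module.finrank F l = 2 := hl
  omega

omit [FiniteDimensional F V] in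
theorem IsLine.exists_ne_zero {l : Submodule F V} (hl : IsLine l) : ∃ x ∈ l, x ≠ 0 := by
  obtain ⟨x, hxl, hx⟩ := hl.exists_notMem_span 0
  exact ⟨x, hxl, fun h => hx (by rw [h]; exact Submodule.zero_mem _)⟩

/-- In a subspace of rank `3` there are `q + 1` lines through a given point. -/
theorem ncard_lines_through_point [Finite F] {W : Submodule F V} (hW : Module.finrank F W = 3)
    {p : V} (hp : p ≠ 0) (hpW : p ∈ W) :
    {l : Submodule F V | IsLine l ∧ p ∈ l ∧ l ≤ W}.ncard = Nat.card F + 1 := by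
  obtain ⟨y, hyW, hy⟩ : ∃ y ∈ W, y ∉ Submodule.span F {p} := by
    by_contra! h
    have h1 := Submodule.finrank_mono (show W ≤ Submodule.span F {p} from h)
    rw [finrank_span_singleton hp] at h1
    omega
  have h2 := finrank_span_pair hp hy
  have hle : Submodule.span F {p, y} ≤ W := by
    rw [Submodule.span_le]
    rintro z (rfl | rfl) <;> assumption
  obtain ⟨z, hzW, hz⟩ : ∃ z ∈ W, z ∉ Submodule.span F {p, y} := by
    by_contra! h
    have h1 := Submodule.finrank_mono (show W ≤ Submodule.span F {p, y} from h)
    omega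
  have hind : ∀ a b c : F, a • p + b • y + c • z = 0 → a = 0 ∧ b = 0 ∧ c = 0 := by
    intro a b c h
    have hc : c = 0 := by
      by_contra hc
      refine hz (Submodule.mem_span_pair.2 ⟨-(c⁻¹ * a), -(c⁻¹ * b), ?_⟩)
      have : z = c⁻¹ • (c • z) := by rw [smul_smul, inv_mul_cancel₀ hc, one_smul]
      rw [this, eq_neg_of_add_eq_zero_right h]
      module
    subst hc
    rw [zero_smul, add_zero] at h
    obtain ⟨h1, h2⟩ := eq_zero_of_smul_add_smul_eq_zero hp hy h
    exact ⟨h1, h2, rfl⟩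
  have hspan : ∀ w ∈ W, ∃ a b c : F, a • p + b • y + c • z = w := by
    have hlt : Submodule.span F {p, y} ⊔ Submodule.span F {z} = W := by
      refine Submodule.eq_of_le_of_finrank_le
        (sup_le hle ((Submodule.span_singleton_le_iff_mem _ _).2 hzW)) ?_
      have h4 : Submodule.span F {p, y} < Submodule.span F {p, y} ⊔ Submodule.span F {z} :=
        lt_of_le_of_ne le_sup_left fun h => hz (h ▸
          (le_sup_right : Submodule.span F {z} ≤ _) (Submodule.mem_span_singleton_self z))
      have := Submodule.finrank_lt_finrank_of_lt h4
      omega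
    intro w hw
    rw [← hlt] at hw
    obtain ⟨u, hu, v, hv, rfl⟩ := Submodule.mem_sup.1 hw
    obtain ⟨a, b, rfl⟩ := Submodule.mem_span_pair.1 hu
    obtain ⟨c, rfl⟩ := Submodule.mem_span_singleton.1 hv
    exact ⟨a, b, c, rfl⟩
  have hza : ∀ a : F, z + a • y ∉ Submodule.span F {p} := by
    intro a h
    obtain ⟨c, hc⟩ := Submodule.mem_span_singleton.1 h
    have := (hind (-c) a 1 (by rw [neg_smul, hc]; module)).2.2
    exact one_ne_zero this
  -- The lines correspond to the points of the projective line of `W / ⟨p⟩`: `none` is the class of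
  -- `y`, and `a` is the class of `z + a y`.
  let f : Option F → Submodule F V := fun o =>
    o.elim (Submodule.span F {p, y}) fun a => Submodule.span F {p, z + a • y}
  have hf : Function.Injective f := by
    have h0 : ∀ a : F, Submodule.span F {p, y} ≠ Submodule.span F {p, z + a • y} := by
      intro a h
      have h1 : z + a • y ∈ Submodule.span F {p, y} := by
        rw [h]; exact Submodule.subset_span (by simp)
      exact hz ((Submodule.add_mem_iff_left _
        (Submodule.smul_mem _ a (Submodule.subset_span (by simp)))).1 h1)
    rintro (_ | a) (_ | b) h
    · rfl
    · exact absurd h (h0 b)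
    · exact absurd h.symm (h0 a)
    · have h1 : z + a • y ∈ Submodule.span F {p, z + b • y} := by
        rw [← show Submodule.span F {p, z + a • y} = Submodule.span F {p, z + b • y} from h]
        exact Submodule.subset_span (by simp)
      obtain ⟨r, s, hrs⟩ := Submodule.mem_span_pair.1 h1
      obtain ⟨-, h2, h3⟩ := hind r (s * b - a) (s - 1) (by
        have := sub_eq_zero.2 hrs
        rw [← this]
        module)
      have hs : s = 1 := sub_eq_zero.1 h3
      rw [hs, one_mul] at h2
      rw [sub_eq_zero.1 h2]
  have hrange : {l : Submodule F V | IsLine l ∧ p ∈ l ∧ l ≤ W} = Set.range f := by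
    ext l
    constructor
    · rintro ⟨hl, hpl, hlW⟩
      obtain ⟨w, hwl, hw⟩ := hl.exists_notMem_span p
      obtain ⟨a, b, c, rfl⟩ := hspan w (hlW hwl)
      have hbc : b • y + c • z ∈ l := by
        rw [add_assoc] at hwl
        exact (Submodule.add_mem_iff_right _ (Submodule.smul_mem _ a hpl)).1 hwl
      by_cases hc : c = 0
      · subst hc
        have hb : b ≠ 0 := by
          rintro rfl
          exact hw (Submodule.mem_span_singleton.2 ⟨a, by simp⟩)
        rw [zero_smul, add_zero, Submodule.smul_mem_iff _ hb] at hbc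
        exact ⟨none, (hl.eq_span_pair hp hpl hbc hy).symm⟩
      · refine ⟨some (c⁻¹ * b), (hl.eq_span_pair hp hpl ?_ (hza _)).symm⟩
        have := Submodule.smul_mem _ c⁻¹ hbc
        rwa [smul_add, smul_smul, smul_smul, inv_mul_cancel₀ hc, one_smul, add_comm] at this
    · rintro ⟨_ | a, rfl⟩
      · exact ⟨h2, Submodule.subset_span (by simp), hle⟩
      · refine ⟨finrank_span_pair hp (hza a), Submodule.subset_span (by simp), ?_⟩
        change Submodule.span F {p, z + a • y} ≤ W
        rw [Submodule.span_le]
        rintro w (rfl | rfl)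
        · exact hpW
        · exact W.add_mem hzW (W.smul_mem a hyW)
  rw [hrange, ← Set.image_univ, Set.ncard_image_of_injective _ hf, Set.ncard_univ,
    Finite.card_option]

end Lines

end ProjGeom

namespace ProjGeom

/-! ### Ranks, points and tangency under collineations -/

section Collineations

variable {F V : Type*} [Field F] [AddCommGroup V] [Module F V]

theorem apply_mem_iff_of_coe_eq_image {g : Submodule F V ≃o Submodule F V} {A : V ≃+ V}
    (hA : ∀ X : Submodule F V, (g X : Set V) = A '' (X : Set V)) {X : Submodule F V} {v : V} :
    A v ∈ g X ↔ v ∈ X := by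
  rw [← SetLike.mem_coe, hA, A.injective.mem_set_image, SetLike.mem_coe]

/-- The inducing map is only semilinear, but it is a bijection, and over a finite field the
cardinality of a subspace determines its rank. -/
theorem IsCollineation.finrank_eq [Finite F] [FiniteDimensional F V]
    {g : Submodule F V ≃o Submodule F V} (hg : IsCollineation g) (X : Submodule F V) :
    Module.finrank F (g X) = Module.finrank F X := by
  obtain ⟨μ, A, -, hA⟩ := hg
  have h : Nat.card (g X) = Nat.card X := by
    change Nat.card (g X : Set V) = Nat.card (X : Set V)
    rw [hA, Nat.card_image_of_injective A.injective]
  rw [Module.natCard_eq_pow_finrank (K := F) (V := g X),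
    Module.natCard_eq_pow_finrank (K := F) (V := X)] at h
  exact Nat.pow_right_injective (Finite.one_lt_card (α := F)) h

theorem IsCollineation.isPoint_iff [Finite F] [FiniteDimensional F V]
    {g : Submodule F V ≃o Submodule F V} (hg : IsCollineation g) {X : Submodule F V} :
    IsPoint (g X) ↔ IsPoint X := by
  rw [IsPoint, hg.finrank_eq, IsPoint]

theorem IsCollineation.isLine_iff [Finite F] [FiniteDimensional F V]
    {g : Submodule F V ≃o Submodule F V} (hg : IsCollineation g) {X : Submodule F V} :
    IsLine (g X) ↔ IsLine X := by
  rw [IsLine, hg.finrank_eq, IsLine]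

theorem apply_span_singleton {g : Submodule F V ≃o Submodule F V} {μ : F ≃+* F} {A : V ≃+ V}
    (hμ : ∀ (a : F) (v : V), A (a • v) = μ a • A v)
    (hA : ∀ X : Submodule F V, (g X : Set V) = A '' (X : Set V)) (v : V) :
    g (Submodule.span F {v}) = Submodule.span F {A v} := by
  apply le_antisymm
  · intro w hw
    obtain ⟨u, hu, rfl⟩ : w ∈ A '' (Submodule.span F {v} : Set V) := by
      rw [← hA]; exact hw
    obtain ⟨a, rfl⟩ := Submodule.mem_span_singleton.1 hu
    exact Submodule.mem_span_singleton.2 ⟨μ a, (hμ a v).symm⟩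
  · rw [Submodule.span_singleton_le_iff_mem, apply_mem_iff_of_coe_eq_image hA]
    exact Submodule.mem_span_singleton_self v

theorem IsTangentLine.apply [Finite F] [FiniteDimensional F V]
    {g : Submodule F V ≃o Submodule F V} (hg : IsCollineation g) {O : Set (Submodule F V)}
    (hO : ∀ P, g P ∈ O ↔ P ∈ O) {l : Submodule F V} (hl : IsTangentLine O l) :
    IsTangentLine O (g l) := by
  obtain ⟨h1, P, ⟨hP, hPl⟩, hu⟩ := hl
  refine ⟨hg.isLine_iff.2 h1, g P, ⟨(hO P).2 hP, g.monotone hPl⟩, ?_⟩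
  rintro R ⟨hR, hRl⟩
  obtain ⟨R, rfl⟩ := g.surjective R
  rw [hu R ⟨(hO R).1 hR, g.le_iff_le.1 hRl⟩]

end Collineations

/-! ### The polar form of an elliptic quadric in characteristic 2 -/

section Forms

variable {F V : Type*} [Field F] [AddCommGroup V] [Module F V]

/-- `O` is the set of singular points of the quadratic form `Q` with alternating non-degenerate
polar form `B`, and no line consists of singular points. -/
structure IsEllipticForm (O : Set (Submodule F V)) (Q : V → F) (B : V →ₗ[F] V →ₗ[F] F) :
    Prop where
  polar_add : ∀ x y, Q (x + y) = Q x + Q y + B x y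
  quad_smul : ∀ (a : F) x, Q (a • x) = a ^ 2 * Q x
  alt : ∀ x, B x x = 0
  symm : ∀ x y, B x y = B y x
  nondegenerate : ∀ x, (∀ y, B x y = 0) → x = 0
  mem_iff : ∀ P, P ∈ O ↔ IsPoint P ∧ ∀ x ∈ P, Q x = 0
  mem_span : ∀ x y, Q x = 0 → Q y = 0 → B x y = 0 → x ≠ 0 → y ∈ Submodule.span F {x}

theorem exists_sq_eq [Finite F] [CharP F 2] (c : F) : ∃ s : F, s ^ 2 = c := by
  obtain ⟨s, hs⟩ := FiniteField.isSquare_of_char_two (ringChar.eq F 2) c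
  exact ⟨s, by rw [hs, sq]⟩

/-- With `a = r²` and `b = s²` the expression is `(u r + v s)²`, so only one linear equation in two
unknowns has to be solved. -/
theorem exists_sq_mul_add_sq_mul_eq_zero [Finite F] [CharP F 2] (a b : F) :
    ∃ u v : F, (u ≠ 0 ∨ v ≠ 0) ∧ u ^ 2 * a + v ^ 2 * b = 0 := by
  obtain ⟨r, rfl⟩ := exists_sq_eq a
  obtain ⟨s, rfl⟩ := exists_sq_eq b
  by_cases hr : r = 0
  · exact ⟨1, 0, Or.inl one_ne_zero, by simp [hr]⟩
  · refine ⟨s, r, Or.inr hr, ?_⟩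
    rw [mul_comm]
    exact CharTwo.add_self_eq_zero _

theorem quadratic_eq_zero_imp {b c : F}
    (hirr : Irreducible (Polynomial.X ^ 2 + Polynomial.C b * Polynomial.X + Polynomial.C c))
    {y z : F} (h : y ^ 2 + b * y * z + c * z ^ 2 = 0) : y = 0 ∧ z = 0 := by
  have hz : z = 0 := by
    by_contra hz
    have hdeg := Polynomial.natDegree_quadratic (a := (1 : F)) (b := b) (c := c) one_ne_zero
    rw [map_one, one_mul] at hdeg
    refine hirr.not_isRoot_of_natDegree_ne_one (by omega) (x := y / z) ?_
    rw [Polynomial.IsRoot.def]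
    simp only [Polynomial.eval_add, Polynomial.eval_pow, Polynomial.eval_X, Polynomial.eval_mul,
      Polynomial.eval_C]
    field_simp
    linear_combination h
  subst hz
  exact ⟨by simpa using h, rfl⟩

theorem irreducible_quadratic_coeff_ne_zero [Finite F] [CharP F 2] {b c : F}
    (hirr : Irreducible (Polynomial.X ^ 2 + Polynomial.C b * Polynomial.X + Polynomial.C c)) :
    b ≠ 0 := by
  rintro rfl
  obtain ⟨s, rfl⟩ := exists_sq_eq c
  exact one_ne_zero (quadratic_eq_zero_imp hirr (y := s) (z := 1)
    (by linear_combination CharTwo.add_self_eq_zero (s ^ 2))).2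

/-- No line of the standard elliptic quadric: two orthogonal singular vectors are proportional. -/
theorem mem_span_of_standard_singular [CharP F 2] {b c : F}
    (hirr : Irreducible (Polynomial.X ^ 2 + Polynomial.C b * Polynomial.X + Polynomial.C c))
    {x y : Fin 4 → F}
    (hx : x 0 * x 1 + x 2 ^ 2 + b * x 2 * x 3 + c * x 3 ^ 2 = 0)
    (hy : y 0 * y 1 + y 2 ^ 2 + b * y 2 * y 3 + c * y 3 ^ 2 = 0)
    (hxy : x 0 * y 1 + x 1 * y 0 + b * (x 2 * y 3 + x 3 * y 2) = 0) (hx0 : x ≠ 0) :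
    y ∈ Submodule.span F {x} := by
  -- The vector `x i • y - y i • x` is singular, as is every combination of `x` and `y`, and its
  -- `i`-th coordinate is zero. So the anisotropic binary form vanishes on its last two coordinates.
  have key : ∀ i : Fin 4, i = 0 ∨ i = 1 → x i * y 2 - y i * x 2 = 0 ∧ x i * y 3 - y i * x 3 = 0 := by
    intro i hi
    apply quadratic_eq_zero_imp hirr
    have h2 : (2 : F) = 0 := CharTwo.two_eq_zero
    rcases hi with rfl | rfl
    · linear_combination x 0 ^ 2 * hy + y 0 ^ 2 * hx - x 0 * y 0 * hxy +
        h2 * (- x 0 * y 0 * x 2 * y 2 - c * x 0 * y 0 * x 3 * y 3)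
    · linear_combination x 1 ^ 2 * hy + y 1 ^ 2 * hx - x 1 * y 1 * hxy +
        h2 * (- x 1 * y 1 * x 2 * y 2 - c * x 1 * y 1 * x 3 * y 3)
  obtain ⟨h02, h03⟩ := key 0 (Or.inl rfl)
  obtain ⟨h12, h13⟩ := key 1 (Or.inr rfl)
  have h01 : x 0 ≠ 0 ∨ x 1 ≠ 0 := by
    by_contra! h
    obtain ⟨h2, h3⟩ := quadratic_eq_zero_imp hirr (y := x 2) (z := x 3)
      (by linear_combination hx - x 1 * h.1)
    refine hx0 (funext fun i => ?_)
    fin_cases i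
    exacts [h.1, h.2, h2, h3]
  have hm : x 2 * y 3 - x 3 * y 2 = 0 := by
    rcases h01 with h | h
    · exact (mul_eq_zero.1 (show x 0 * (x 2 * y 3 - x 3 * y 2) = 0 by
        linear_combination x 2 * h03 - x 3 * h02)).resolve_left h
    · exact (mul_eq_zero.1 (show x 1 * (x 2 * y 3 - x 3 * y 2) = 0 by
        linear_combination x 2 * h13 - x 3 * h12)).resolve_left h
  have hd : x 0 * y 1 - x 1 * y 0 = 0 := by
    have h2 : (2 : F) = 0 := CharTwo.two_eq_zero
    linear_combination hxy - b * hm - h2 * (x 1 * y 0 + b * x 3 * y 2)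
  rw [Submodule.mem_span_singleton]
  rcases h01 with h | h
  · refine ⟨y 0 / x 0, funext fun i => ?_⟩
    rw [Pi.smul_apply, smul_eq_mul, div_mul_eq_mul_div, div_eq_iff h]
    fin_cases i <;> dsimp
    · linear_combination -hd
    · linear_combination -h02
    · linear_combination -h03
  · refine ⟨y 1 / x 1, funext fun i => ?_⟩
    rw [Pi.smul_apply, smul_eq_mul, div_mul_eq_mul_div, div_eq_iff h]
    fin_cases i <;> dsimp
    · linear_combination hd
    · linear_combination -h12
    · linear_combination -h13

/-- The standard form is pulled back along the semilinear map of the collineation; applying `μ.symm`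
to its values undoes the twist of scalars and makes the polar form bilinear. -/
theorem IsEllipticQuadric.exists_isEllipticForm [Finite F] [CharP F 2]
    {O : Set (Submodule F (Fin 4 → F))} (hO : IsEllipticQuadric O) :
    ∃ (Q : (Fin 4 → F) → F) (B : (Fin 4 → F) →ₗ[F] (Fin 4 → F) →ₗ[F] F),
      IsEllipticForm O Q B := by
  obtain ⟨b, c, hirr, τ, hτ, hτO⟩ := hO
  have hb := irreducible_quadratic_coeff_ne_zero hirr
  obtain ⟨μ, A, hμ, hA⟩ := id hτ
  have h2 : (2 : F) = 0 := CharTwo.two_eq_zero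
  let Q₀ : (Fin 4 → F) → F := fun x => x 0 * x 1 + x 2 ^ 2 + b * x 2 * x 3 + c * x 3 ^ 2
  let B₀ : (Fin 4 → F) → (Fin 4 → F) → F := fun x y =>
    x 0 * y 1 + x 1 * y 0 + b * (x 2 * y 3 + x 3 * y 2)
  have hsymm : ∀ x y, B₀ x y = B₀ y x := fun x y => by simp only [B₀]; ring
  have hadd : ∀ x y z, B₀ (x + y) z = B₀ x z + B₀ y z := fun x y z => by
    simp only [B₀, Pi.add_apply]; ring
  have hsmul : ∀ (a : F) x y, B₀ (a • x) y = a * B₀ x y := fun a x y => by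
    simp only [B₀, Pi.smul_apply, smul_eq_mul]; ring
  have hcalc : ∀ a x, μ.symm (μ a * x) = a * μ.symm x := fun a x => by
    rw [map_mul, RingEquiv.symm_apply_apply]
  let B : (Fin 4 → F) →ₗ[F] (Fin 4 → F) →ₗ[F] F :=
    LinearMap.mk₂ F (fun x y => μ.symm (B₀ (A x) (A y)))
      (fun x y z => by rw [map_add A, hadd, map_add])
      (fun a x y => by rw [hμ, hsmul, hcalc, smul_eq_mul])
      (fun x y z => by rw [map_add A, hsymm, hadd, map_add, hsymm, hsymm (A z)])
      (fun a x y => by rw [hμ, hsymm, hsmul, hcalc, hsymm, smul_eq_mul])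
  have hB : ∀ x y, B x y = μ.symm (B₀ (A x) (A y)) := fun x y => rfl
  refine ⟨fun x => μ.symm (Q₀ (A x)), B, ?_, ?_, ?_, ?_, ?_, ?_, ?_⟩
  · intro x y
    rw [hB, ← map_add, ← map_add, map_add A]
    congr 1
    simp only [Q₀, B₀, Pi.add_apply]
    linear_combination h2 * (A x 2 * A y 2 + c * A x 3 * A y 3)
  · intro a x
    have : Q₀ (A (a • x)) = μ (a ^ 2) * Q₀ (A x) := by
      rw [hμ, map_pow]
      simp only [Q₀, Pi.smul_apply, smul_eq_mul]
      ring
    simp only [this, hcalc]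
  · intro x
    rw [hB, map_eq_zero_iff _ μ.symm.injective]
    simp only [B₀]
    linear_combination h2 * (A x 0 * A x 1 + b * A x 2 * A x 3)
  · intro x y
    rw [hB, hB, hsymm]
  · intro x hx
    have h : ∀ z, B₀ (A x) z = 0 := fun z => by
      have := hx (A.symm z)
      rwa [hB, A.apply_symm_apply, map_eq_zero_iff _ μ.symm.injective] at this
    rw [← map_eq_zero_iff A A.injective]
    funext i
    fin_cases i
    · simpa [B₀] using h (Pi.single 1 1)
    · simpa [B₀] using h (Pi.single 0 1)
    -- Here `b ≠ 0` matters: the last two coordinates enter the polar form only through `b`.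
    · simpa [B₀, hb] using h (Pi.single 3 1)
    · simpa [B₀, hb] using h (Pi.single 2 1)
  · intro P
    rw [← τ.injective.mem_set_image, hτO]
    constructor
    · rintro ⟨h1, h2⟩
      refine ⟨hτ.isPoint_iff.1 h1, fun x hx => ?_⟩
      rw [map_eq_zero_iff _ μ.symm.injective]
      exact h2 _ ((apply_mem_iff_of_coe_eq_image hA).2 hx)
    · rintro ⟨h1, h2⟩
      refine ⟨hτ.isPoint_iff.2 h1, fun x hx => ?_⟩
      obtain ⟨x, rfl⟩ := A.surjective x
      have := h2 x ((apply_mem_iff_of_coe_eq_image hA).1 hx)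
      rwa [map_eq_zero_iff _ μ.symm.injective] at this
  · intro x y hx hy hxy hx0
    rw [map_eq_zero_iff _ μ.symm.injective] at hx hy
    rw [hB, map_eq_zero_iff _ μ.symm.injective] at hxy
    have := mem_span_of_standard_singular hirr hx hy hxy
      (fun h => hx0 ((map_eq_zero_iff A A.injective).1 h))
    rwa [← apply_span_singleton hμ hA, apply_mem_iff_of_coe_eq_image hA] at this

namespace IsEllipticForm

variable {O : Set (Submodule F V)} {Q : V → F} {B : V →ₗ[F] V →ₗ[F] F}

theorem span_mem (h : IsEllipticForm O Q B) {x : V} (hx : x ≠ 0) (hQ : Q x = 0) :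
    Submodule.span F {x} ∈ O := by
  refine (h.mem_iff _).2 ⟨isPoint_span hx, fun y hy => ?_⟩
  obtain ⟨a, rfl⟩ := Submodule.mem_span_singleton.1 hy
  rw [h.quad_smul, hQ, mul_zero]

/-- The lines tangent to `O` are the lines that are totally isotropic for the polar form. -/
theorem isTangentLine_iff [Finite F] [CharP F 2] [FiniteDimensional F V]
    (h : IsEllipticForm O Q B) {l : Submodule F V} (hl : IsLine l) :
    IsTangentLine O l ↔ ∀ x ∈ l, ∀ y ∈ l, B x y = 0 := by
  constructor
  · rintro ⟨-, P, ⟨hP, hPl⟩, hu⟩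
    obtain ⟨hP1, hP2⟩ := (h.mem_iff P).1 hP
    obtain ⟨p, hp, rfl⟩ := hP1.exists_eq_span
    have hpl := hPl (Submodule.mem_span_singleton_self p)
    have hQp := hP2 p (Submodule.mem_span_singleton_self p)
    obtain ⟨y, hyl, hy⟩ := hl.exists_notMem_span p
    have hpy : B p y = 0 := by
      by_contra hne
      -- Since `Q (a p + y) = a B(p, y) + Q y`, this `a` yields a second singular point on the line.
      set a := -(Q y / B p y) with ha
      have hz : a • p + y ∉ Submodule.span F {p} := fun hz => hy
        ((Submodule.add_mem_iff_right _ (Submodule.smul_mem _ a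
          (Submodule.mem_span_singleton_self p))).1 hz)
      have hz0 : a • p + y ≠ 0 := fun h0 => hz (h0 ▸ Submodule.zero_mem _)
      have hQz : Q (a • p + y) = 0 := by
        rw [h.polar_add, h.quad_smul, hQp, map_smul, LinearMap.smul_apply, smul_eq_mul, ha]
        field_simp
        ring
      have := hu _ ⟨h.span_mem hz0 hQz, (Submodule.span_singleton_le_iff_mem _ _).2
        (l.add_mem (l.smul_mem a hpl) hyl)⟩
      exact hz (this ▸ Submodule.mem_span_singleton_self (a • p + y))
    have hlspan := hl.eq_span_pair hp hpl hyl hy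
    intro x hx z hz
    rw [hlspan] at hx hz
    obtain ⟨a, b, rfl⟩ := Submodule.mem_span_pair.1 hx
    obtain ⟨a', b', rfl⟩ := Submodule.mem_span_pair.1 hz
    simp [h.alt, hpy, h.symm y p]
  · intro hB
    obtain ⟨x, hxl, hx⟩ := hl.exists_ne_zero
    obtain ⟨y, hyl, hy⟩ := hl.exists_notMem_span x
    -- On an isotropic line `Q` is additive with `Q (a x) = a² Q x`, so it has a nontrivial zero;
    -- `mem_span` makes the singular point unique.
    obtain ⟨u, v, huv, hz⟩ := exists_sq_mul_add_sq_mul_eq_zero (Q x) (Q y)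
    have hz0 : u • x + v • y ≠ 0 := fun h0 => by
      obtain ⟨rfl, rfl⟩ := eq_zero_of_smul_add_smul_eq_zero hx hy h0
      simp at huv
    have hzl : u • x + v • y ∈ l := l.add_mem (l.smul_mem u hxl) (l.smul_mem v hyl)
    have hQz : Q (u • x + v • y) = 0 := by
      rw [h.polar_add, h.quad_smul, h.quad_smul, hB _ (l.smul_mem u hxl) _ (l.smul_mem v hyl), hz,
        add_zero]
    refine ⟨hl, _, ⟨h.span_mem hz0 hQz, (Submodule.span_singleton_le_iff_mem _ _).2 hzl⟩, ?_⟩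
    rintro R ⟨hR, hRl⟩
    obtain ⟨hR1, hR2⟩ := (h.mem_iff R).1 hR
    obtain ⟨r, hr, rfl⟩ := hR1.exists_eq_span
    have hr' := Submodule.mem_span_singleton_self (R := F) r
    exact span_singleton_eq_of_mem hr
      (h.mem_span _ _ hQz (hR2 r hr') (hB _ hzl _ (hRl hr')) hz0)

theorem ncard_tangentLines [Finite F] [CharP F 2] [FiniteDimensional F V]
    (h : IsEllipticForm O Q B) (hV : Module.finrank F V = 4) {P : Submodule F V} (hP : P ∈ O) :
    {l | IsTangentLine O l ∧ P ≤ l}.ncard = Nat.card F + 1 := by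
  obtain ⟨p, hp, rfl⟩ := ((h.mem_iff P).1 hP).1.exists_eq_span
  have hBp : B p ≠ 0 := fun h0 => hp (h.nondegenerate p fun y => by rw [h0]; rfl)
  have hker : Module.finrank F (LinearMap.ker (B p)) = 3 := by
    have h1 := LinearMap.finrank_range_add_finrank_ker (B p)
    rw [LinearMap.range_eq_top.2 (LinearMap.surjective hBp), finrank_top, Module.finrank_self]
      at h1
    omega
  rw [← ncard_lines_through_point hker hp (h.alt p)]
  congr 1
  ext l
  simp only [Set.mem_ofPred_eq, Submodule.span_singleton_le_iff_mem]
  constructor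
  · rintro ⟨hl, hpl⟩
    exact ⟨hl.1, hpl, fun y hy => (h.isTangentLine_iff hl.1).1 hl p hpl y hy⟩
  · rintro ⟨hl, hpl, hle⟩
    refine ⟨(h.isTangentLine_iff hl).2 ?_, hpl⟩
    obtain ⟨y, hyl, hy⟩ := hl.exists_notMem_span p
    have hpy : B p y = 0 := hle hyl
    have hlspan := hl.eq_span_pair hp hpl hyl hy
    intro x hx z hz
    rw [hlspan] at hx hz
    obtain ⟨a, b, rfl⟩ := Submodule.mem_span_pair.1 hx
    obtain ⟨a', b', rfl⟩ := Submodule.mem_span_pair.1 hz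
    simp [h.alt, hpy, h.symm y p]

end IsEllipticForm

end Forms

end ProjGeom

namespace ProjGeom

/-! ### Semilinear maps fixing the lines of a totally isotropic spread -/

section Spreads

variable {F V : Type*} [Field F] [AddCommGroup V] [Module F V]

namespace IsLineSpread

variable {𝓢 : Set (Submodule F V)}

theorem exists_mem (h : IsLineSpread 𝓢) {v : V} (hv : v ≠ 0) : ∃ l ∈ 𝓢, v ∈ l := by
  obtain ⟨l, ⟨hl, hvl⟩, -⟩ := h.2.2 _ (isPoint_span (F := F) hv)
  exact ⟨l, hl, (Submodule.span_singleton_le_iff_mem _ _).1 hvl⟩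

theorem eq_of_point_le (h : IsLineSpread 𝓢) {l m P : Submodule F V} (hl : l ∈ 𝓢) (hm : m ∈ 𝓢)
    (hP : IsPoint P) (hPl : P ≤ l) (hPm : P ≤ m) : l = m :=
  (h.2.2 P hP).unique ⟨hl, hPl⟩ ⟨hm, hPm⟩

theorem exists_ne_of_notMem [FiniteDimensional F V] (h : IsLineSpread 𝓢) {t : Submodule F V}
    (ht : IsLine t) (htS : t ∉ 𝓢) :
    ∃ x ∈ t, ∃ y ∈ t, x ≠ 0 ∧ y ≠ 0 ∧ y ∉ Submodule.span F {x} ∧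
      ∃ l ∈ 𝓢, ∃ m ∈ 𝓢, x ∈ l ∧ y ∈ m ∧ l ≠ m := by
  obtain ⟨x, hxt, hx⟩ := ht.exists_ne_zero
  obtain ⟨y, hyt, hy⟩ := ht.exists_notMem_span x
  have hy0 : y ≠ 0 := fun h0 => hy (h0 ▸ Submodule.zero_mem _)
  obtain ⟨l, hl, hxl⟩ := h.exists_mem hx
  obtain ⟨m, hm, hym⟩ := h.exists_mem hy0
  refine ⟨x, hxt, y, hyt, hx, hy0, hy, l, hl, m, hm, hxl, hym, ?_⟩
  rintro rfl
  exact htS (by rwa [ht.eq_span_pair hx hxt hyt hy, ← (h.1 l hl).eq_span_pair hx hxl hym hy])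

end IsLineSpread

theorem eq_zero_of_add_eq_zero_of_disjoint {l m : Submodule F V} (hlm : Disjoint l m)
    {x x' y y' : V} (hxl : x ∈ l) (hxl' : x' ∈ l) (hym : y ∈ m) (hym' : y' ∈ m) (hx : x ≠ 0)
    (hx' : x' ∉ Submodule.span F {x}) (hy : y ≠ 0) (hy' : y' ∉ Submodule.span F {y})
    {a b c d : F} (h : a • x + b • x' + (c • y + d • y') = 0) :
    (a = 0 ∧ b = 0) ∧ c = 0 ∧ d = 0 := by
  have h1 : a • x + b • x' = -(c • y + d • y') := eq_neg_of_add_eq_zero_left h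
  have hl : a • x + b • x' ∈ l := l.add_mem (l.smul_mem a hxl) (l.smul_mem b hxl')
  have hm : c • y + d • y' ∈ m := m.add_mem (m.smul_mem c hym) (m.smul_mem d hym')
  have h2 := Submodule.disjoint_def.1 hlm _ hl (h1 ▸ m.neg_mem hm)
  rw [h2, zero_add] at h
  exact ⟨eq_zero_of_smul_add_smul_eq_zero hx hx' h2, eq_zero_of_smul_add_smul_eq_zero hy hy' h⟩

theorem sup_eq_top_of_isLine [FiniteDimensional F V] (hV : Module.finrank F V = 4)
    {l m : Submodule F V} (hl : IsLine l) (hm : IsLine m) (hlm : Disjoint l m) : l ⊔ m = ⊤ := by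
  apply Submodule.eq_top_of_finrank_eq
  have h := Submodule.finrank_sup_add_finrank_inf_eq l m
  rw [hlm.eq_bot, finrank_bot, show Module.finrank F l = 2 from hl,
    show Module.finrank F m = 2 from hm] at h
  omega

namespace IsEllipticForm

variable [Finite F] [CharP F 2] [FiniteDimensional F V]
  {O : Set (Submodule F V)} {Q : V → F} {B : V →ₗ[F] V →ₗ[F] F} {𝓢 : Set (Submodule F V)}
  {A : V ≃+ V}

omit [Finite F] [FiniteDimensional F V] in
/-- An additive map `A` with `B v (A v) = 0` for all `v` is self-adjoint. -/
theorem apply_comm_of_isotropic (h : IsEllipticForm O Q B) (hBA : ∀ v, B v (A v) = 0) (x y : V) :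
    B (A x) y = B x (A y) := by
  have h1 := hBA (x + y)
  rw [map_add A, map_add, map_add, LinearMap.add_apply, LinearMap.add_apply, hBA, hBA, zero_add,
    add_zero, h.symm y (A x)] at h1
  exact CharTwo.add_eq_zero.1 h1

omit [Finite F] [FiniteDimensional F V] in
/-- A semilinear bijection `A` with `B v (A v) = 0` for all `v` is linear. -/
theorem companion_eq_of_isotropic [Nontrivial V] (h : IsEllipticForm O Q B) {μ : F ≃+* F}
    (hμ : ∀ (a : F) (v : V), A (a • v) = μ a • A v) (hBA : ∀ v, B v (A v) = 0) (a : F) :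
    μ a = a := by
  obtain ⟨x, hx⟩ := exists_ne (0 : V)
  obtain ⟨z, hz⟩ : ∃ z, B x z ≠ 0 := by
    by_contra! h0
    exact hx (h.nondegenerate x h0)
  obtain ⟨y, rfl⟩ := A.surjective z
  -- On the left the scalar leaves `A` as `μ a`, on the right it leaves `B` as `a`.
  have h1 := h.apply_comm_of_isotropic hBA (a • x) y
  rw [hμ, map_smul, map_smul, LinearMap.smul_apply, LinearMap.smul_apply, smul_eq_mul,
    smul_eq_mul, h.apply_comm_of_isotropic hBA] at h1
  exact mul_right_cancel₀ hz h1

/-- Let the lines of a spread be totally isotropic. If a semilinear map without fixed points that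
fixes each of them maps a totally isotropic line `t` to such a line, then `t` is in the spread. -/
theorem mem_spread_of_isotropic_image (h : IsEllipticForm O Q B) (hV : Module.finrank F V = 4)
    (hsp : IsLineSpread 𝓢) (hB : ∀ l ∈ 𝓢, ∀ x ∈ l, ∀ y ∈ l, B x y = 0) {μ : F ≃+* F}
    (hμ : ∀ (a : F) (v : V), A (a • v) = μ a • A v) (hfix : ∀ l ∈ 𝓢, ∀ v ∈ l, A v ∈ l)
    (hne : ∀ v ≠ 0, A v ∉ Submodule.span F {v}) {t : Submodule F V} (ht : IsLine t)
    (hiso : ∀ x ∈ t, ∀ y ∈ t, B x y = 0) (hiso' : ∀ x ∈ t, ∀ y ∈ t, B (A x) (A y) = 0) :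
    t ∈ 𝓢 := by
  by_contra htS
  have hBA : ∀ v, B v (A v) = 0 := by
    intro v
    by_cases hv : v = 0
    · rw [hv, map_zero, LinearMap.zero_apply]
    · obtain ⟨l, hl, hvl⟩ := hsp.exists_mem hv
      exact hB l hl v hvl _ (hfix l hl v hvl)
  have hadj := h.apply_comm_of_isotropic hBA
  obtain ⟨x, hxt, y, hyt, hx, hy, hyx, l, hl, m, hm, hxl, hym, hlm⟩ :=
    hsp.exists_ne_of_notMem ht htS
  have : Nontrivial V := ⟨x, 0, hx⟩
  have hA : ∀ (a : F) (v : V), A (a • v) = a • A v := fun a v => by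
    rw [hμ, h.companion_eq_of_isotropic hμ hBA]
  have hquad : ∀ v ≠ 0, ∃ c d : F, A (A v) = c • v + d • A v := by
    intro v hv
    obtain ⟨k, hk, hvk⟩ := hsp.exists_mem hv
    have hAv := hfix k hk v hvk
    have := hfix k hk _ hAv
    rw [(hsp.1 k hk).eq_span_pair hv hvk hAv (hne v hv)] at this
    obtain ⟨c, d, hcd⟩ := Submodule.mem_span_pair.1 this
    exact ⟨c, d, hcd.symm⟩
  have hxy : x + y ≠ 0 := fun h0 => hyx (Submodule.mem_span_singleton.2
    ⟨-1, by rw [neg_one_smul, neg_eq_of_add_eq_zero_right h0]⟩)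
  obtain ⟨c, d, h1⟩ := hquad x hx
  obtain ⟨c', d', h2⟩ := hquad y hy
  obtain ⟨c'', d'', h3⟩ := hquad (x + y) hxy
  have hdis := hsp.2.1 hl hm hlm
  -- Since `x, A x, y, A y` are independent, comparison at `x + y` forces the same quadratic
  -- relation at `x` and `y`; this yields a contradiction once `B (A x) y = 0` is known.
  obtain ⟨⟨e1, e2⟩, e3, e4⟩ := eq_zero_of_add_eq_zero_of_disjoint hdis hxl (hfix l hl x hxl) hym
    (hfix m hm y hym) hx (hne x hx) hy (hne y hy) (a := c'' - c) (b := d'' - d) (c := c'' - c')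
    (d := d'' - d') (by
      rw [map_add, map_add, h1, h2] at h3
      have := sub_eq_zero.2 h3.symm
      rw [← this]
      module)
  -- If `A² x = s² x`, then `A` maps `A x + s x` to `s` times itself and so fixes a point.
  have hd : d ≠ 0 := by
    rintro rfl
    obtain ⟨s, rfl⟩ := exists_sq_eq c
    have hw : A x + s • x ≠ 0 := fun h0 => hne x hx (Submodule.mem_span_singleton.2
      ⟨-s, by rw [neg_smul, eq_neg_of_add_eq_zero_left h0]⟩)
    refine hne _ hw (Submodule.mem_span_singleton.2 ⟨s, ?_⟩)
    rw [map_add, hA, h1]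
    module
  have hAxy : B (A x) y = 0 := by
    -- By self-adjointness, `0 = B(A x, A y) = B(A² x, y) = c B(x, y) + d B(A x, y)`.
    have h4 := hiso' x hxt y hyt
    rw [← hadj, h1, map_add, map_smul, map_smul, LinearMap.add_apply,
      LinearMap.smul_apply, LinearMap.smul_apply, hiso x hxt y hyt, smul_zero, zero_add,
      smul_eq_mul] at h4
    exact (mul_eq_zero.1 h4).resolve_left hd
  refine hx (h.nondegenerate x fun z => ?_)
  have hz : z ∈ l ⊔ m := by
    rw [sup_eq_top_of_isLine hV (hsp.1 l hl) (hsp.1 m hm) hdis]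
    trivial
  obtain ⟨z1, hz1, z2, hz2, rfl⟩ := Submodule.mem_sup.1 hz
  rw [(hsp.1 m hm).eq_span_pair hy hym (hfix m hm y hym) (hne y hy)] at hz2
  obtain ⟨a, b, rfl⟩ := Submodule.mem_span_pair.1 hz2
  rw [map_add, map_add, map_smul, map_smul, hB l hl x hxl z1 hz1, hiso x hxt y hyt,
    ← hadj, hAxy]
  simp

/-- Let the lines of a spread be totally isotropic, and let `A` be additive, without fixed points
and fix each of them. Any line `t` contains an `x` with a multiple `w` over `F[A]` such that
each semilinear map that fixes the lines of the spread and maps `x` to `w` maps `t` to a totally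
isotropic line. -/
theorem exists_isotropic_image (h : IsEllipticForm O Q B)
    (hsp : IsLineSpread 𝓢) (hB : ∀ l ∈ 𝓢, ∀ x ∈ l, ∀ y ∈ l, B x y = 0)
    (hfix : ∀ l ∈ 𝓢, ∀ v ∈ l, A v ∈ l)
    (hne : ∀ v ≠ 0, A v ∉ Submodule.span F {v}) {t : Submodule F V} (ht : IsLine t)
    (htS : t ∉ 𝓢) :
    ∃ x w : V, x ≠ 0 ∧ w ≠ 0 ∧ (∃ l ∈ 𝓢, x ∈ l ∧ w ∈ l) ∧
      ∀ (ν : F ≃+* F) (C : V ≃+ V), (∀ (a : F) (v : V), C (a • v) = ν a • C v) →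
        (∀ l ∈ 𝓢, ∀ v ∈ l, C v ∈ l) → C x ∈ Submodule.span F {w} →
        ∀ u ∈ t, ∀ v ∈ t, B (C u) (C v) = 0 := by
  have hBA : ∀ v, B v (A v) = 0 := by
    intro v
    by_cases hv : v = 0
    · rw [hv, map_zero, LinearMap.zero_apply]
    · obtain ⟨l, hl, hvl⟩ := hsp.exists_mem hv
      exact hB l hl v hvl _ (hfix l hl v hvl)
  have hadj := h.apply_comm_of_isotropic hBA
  obtain ⟨x, hxt, y, hyt, hx, hy, hyx, l, hl, m, hm, hxl, hym, hlm⟩ :=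
    hsp.exists_ne_of_notMem ht htS
  have hxl' := hfix l hl x hxl
  have hym' := hfix m hm y hym
  -- This is `B (a x + b A x) (a y + b A y) = 0`, because the two mixed terms are equal and cancel.
  obtain ⟨a, b, hab, hq⟩ := exists_sq_mul_add_sq_mul_eq_zero (B x y) (B (A x) (A y))
  have hw : a • x + b • A x ≠ 0 := fun h0 => by
    obtain ⟨rfl, rfl⟩ := eq_zero_of_smul_add_smul_eq_zero hx (hne x hx) h0
    simp at hab
  refine ⟨x, a • x + b • A x, hx, hw,
    ⟨l, hl, hxl, l.add_mem (l.smul_mem a hxl) (l.smul_mem b hxl')⟩, ?_⟩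
  intro ν C hν hC hCx
  obtain ⟨s, hs⟩ := Submodule.mem_span_singleton.1 hCx
  have hCv : ∀ v ≠ 0, ∃ c d : F, C v = c • v + d • A v := by
    intro v hv
    obtain ⟨k, hk, hvk⟩ := hsp.exists_mem hv
    have := hC k hk v hvk
    rw [(hsp.1 k hk).eq_span_pair hv hvk (hfix k hk v hvk) (hne v hv)] at this
    obtain ⟨c, d, hcd⟩ := Submodule.mem_span_pair.1 this
    exact ⟨c, d, hcd.symm⟩
  have hxy : x + y ≠ 0 := fun h0 => hyx (Submodule.mem_span_singleton.2
    ⟨-1, by rw [neg_one_smul, neg_eq_of_add_eq_zero_right h0]⟩)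
  obtain ⟨c', d', h2⟩ := hCv y hy
  obtain ⟨c'', d'', h3⟩ := hCv (x + y) hxy
  -- Comparing at `x + y` shows that `C` acts on `y` with the same coefficients `s a`, `s b` as on
  -- `x`.
  obtain ⟨⟨e1, e2⟩, e3, e4⟩ := eq_zero_of_add_eq_zero_of_disjoint (hsp.2.1 hl hm hlm) hxl hxl' hym
    hym' hx (hne x hx) hy (hne y hy) (a := c'' - s * a) (b := d'' - s * b) (c := c'' - c')
    (d := d'' - d') (by
      rw [map_add, map_add, ← hs, h2] at h3
      have := sub_eq_zero.2 h3.symm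
      rw [← this]
      module)
  have hCy : C y = s • (a • y + b • A y) := by
    rw [h2, ← sub_eq_zero.1 e3, ← sub_eq_zero.1 e4, sub_eq_zero.1 e1, sub_eq_zero.1 e2]
    module
  have hBxy : B (C x) (C y) = 0 := by
    rw [← hs, hCy]
    simp only [map_add, map_smul, LinearMap.add_apply, LinearMap.smul_apply, smul_eq_mul]
    rw [hadj x y]
    linear_combination s ^ 2 * hq + s ^ 2 * a * b * CharTwo.add_self_eq_zero (B x (A y))
  intro u hu v hv
  rw [ht.eq_span_pair hx hxt hyt hyx] at hu hv
  obtain ⟨c, d, rfl⟩ := Submodule.mem_span_pair.1 hu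
  obtain ⟨c', d', rfl⟩ := Submodule.mem_span_pair.1 hv
  simp only [map_add, hν, map_smul, LinearMap.add_apply, LinearMap.smul_apply, h.alt,
    hBxy, h.symm (C y) (C x), smul_zero, add_zero]

end IsEllipticForm

end Spreads

/-! ### The action of a Singer cycle on an invariant spread -/

section SingerCycle

variable {F V : Type*} [Field F] [AddCommGroup V] [Module F V]
  {S : Subgroup (Submodule F V ≃o Submodule F V)} {𝓢 : Set (Submodule F V)}

namespace IsSingerCycle

theorem mul_comm (hS : IsSingerCycle S) {g h : Submodule F V ≃o Submodule F V} (hg : g ∈ S)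
    (hh : h ∈ S) : g * h = h * g := by
  have := hS.2.1
  let := IsCyclic.commGroup (α := S)
  exact congrArg Subtype.val (_root_.mul_comm (⟨g, hg⟩ : S) ⟨h, hh⟩)

theorem exists_apply_eq (hS : IsSingerCycle S) {P R : Submodule F V} (hP : IsPoint P)
    (hR : IsPoint R) : ∃ g ∈ S, g P = R :=
  (hS.2.2.2 P hP R hR).exists

theorem eq_one_of_apply_eq (hS : IsSingerCycle S) {g : Submodule F V ≃o Submodule F V}
    (hg : g ∈ S) {P : Submodule F V} (hP : IsPoint P) (h : g P = P) : g = 1 :=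
  (hS.2.2.2 P hP P hP).unique ⟨hg, h⟩ ⟨S.one_mem, rfl⟩

theorem exists_apply_eq_of_mem_spread (hS : IsSingerCycle S) (hsp : IsLineSpread 𝓢)
    (hstab : Stabilises S 𝓢) {l m : Submodule F V} (hl : l ∈ 𝓢) (hm : m ∈ 𝓢) :
    ∃ g ∈ S, g l = m := by
  obtain ⟨x, hxl, hx⟩ := (hsp.1 l hl).exists_ne_zero
  obtain ⟨y, hym, hy⟩ := (hsp.1 m hm).exists_ne_zero
  obtain ⟨g, hg, hgxy⟩ := hS.exists_apply_eq (isPoint_span (F := F) hx) (isPoint_span (F := F) hy)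
  refine ⟨g, hg, hsp.eq_of_point_le (hstab g hg l hl) hm (isPoint_span hy) ?_
    ((Submodule.span_singleton_le_iff_mem _ _).2 hym)⟩
  rw [← hgxy]
  exact g.monotone ((Submodule.span_singleton_le_iff_mem _ _).2 hxl)

/-- An element of `S` that fixes a line of a spread stabilised by `S` fixes all its lines. -/
theorem apply_eq_of_mem_spread (hS : IsSingerCycle S) (hsp : IsLineSpread 𝓢)
    (hstab : Stabilises S 𝓢) {g : Submodule F V ≃o Submodule F V} (hg : g ∈ S)
    {l m : Submodule F V} (hl : l ∈ 𝓢) (hm : m ∈ 𝓢) (h : g l = l) : g m = m := by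
  obtain ⟨k, hk, rfl⟩ := hS.exists_apply_eq_of_mem_spread hsp hstab hl hm
  change (g * k) l = k l
  rw [hS.mul_comm hg hk]
  change k (g l) = k l
  rw [h]

end IsSingerCycle

end SingerCycle

end ProjGeom

namespace ProjGeom

/-! ### Factorisation of the Singer cycle and the starter set -/

section Main

variable {F V : Type*} [Field F] [AddCommGroup V] [Module F V]
  {S : Subgroup (Submodule F V ≃o Submodule F V)} {𝓢 : Set (Submodule F V)}

theorem ActsRegularlyOn.apply_mem_iff {O : Set (Submodule F V)} (h : ActsRegularlyOn S O)
    {g : Submodule F V ≃o Submodule F V} (hg : g ∈ S) (P : Submodule F V) : g P ∈ O ↔ P ∈ O := by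
  refine ⟨fun hP => ?_, h.1 g hg P⟩
  have h1 := h.1 g⁻¹ (S.inv_mem hg) _ hP
  rwa [show g⁻¹ (g P) = P from g.symm_apply_apply P] at h1

namespace IsSingerCycle

theorem apply_notMem_span (hS : IsSingerCycle S) {g : Submodule F V ≃o Submodule F V}
    (hg : g ∈ S) (hg1 : g ≠ 1) {μ : F ≃+* F} {A : V ≃+ V}
    (hμ : ∀ (a : F) (v : V), A (a • v) = μ a • A v)
    (hA : ∀ X : Submodule F V, (g X : Set V) = A '' (X : Set V)) {v : V} (hv : v ≠ 0) :
    A v ∉ Submodule.span F {v} := by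
  intro h
  refine hg1 (hS.eq_one_of_apply_eq hg (isPoint_span (F := F) hv) ?_)
  rw [apply_span_singleton hμ hA]
  exact span_singleton_eq_of_mem ((map_ne_zero_iff A A.injective).2 hv) h

/-- If `O` is a set of points regular under `S₂ ≤ S` that meets every line of the spread, then `S`
is the product of `S₂` and the elements of `S` that fix all lines of the spread. -/
theorem exists_mul_fixing_spread (hS : IsSingerCycle S) (hsp : IsLineSpread 𝓢)
    (hstab : Stabilises S 𝓢) {S₂ : Subgroup (Submodule F V ≃o Submodule F V)} (hS₂ : S₂ ≤ S)
    {O : Set (Submodule F V)} (hO : ∀ P ∈ O, IsPoint P)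
    (htan : ∀ l ∈ 𝓢, IsTangentLine O l) (hreg : ActsRegularlyOn S₂ O)
    {P : Submodule F V} (hP : P ∈ O) {g : Submodule F V ≃o Submodule F V} (hg : g ∈ S) :
    ∃ g₂ ∈ S₂, ∃ g₁ ∈ S, g = g₂ * g₁ ∧ ∀ l ∈ 𝓢, g₁ l = l := by
  obtain ⟨l, ⟨hl, hPl⟩, -⟩ := hsp.2.2 P (hO P hP)
  obtain ⟨-, R, ⟨hR, hRl⟩, -⟩ := htan _ (hstab g hg l hl)
  -- Moving the tangency point of `l` to that of `g l` makes `g₂` agree with `g` on `l`.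
  obtain ⟨g₂, ⟨hg₂, hPR⟩, -⟩ := hreg.2 P hP R hR
  have hg₂l : g₂ l = g l := hsp.eq_of_point_le (hstab g₂ (hS₂ hg₂) l hl) (hstab g hg l hl)
    (hO R hR) (hPR ▸ g₂.monotone hPl) hRl
  have hg₁ : g₂⁻¹ * g ∈ S := S.mul_mem (S.inv_mem (hS₂ hg₂)) hg
  refine ⟨g₂, hg₂, g₂⁻¹ * g, hg₁, (mul_inv_cancel_left g₂ g).symm, fun m hm =>
    hS.apply_eq_of_mem_spread hsp hstab hg₁ hl hm ?_⟩
  change g₂⁻¹ (g l) = l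
  rw [← hg₂l]
  exact g₂.symm_apply_apply l

/-- An element moving a point within its spread line fixes that line, hence, `S` being abelian and
transitive on the spread, all spread lines. -/
theorem apply_eq_of_mem (hS : IsSingerCycle S) (hsp : IsLineSpread 𝓢)
    (hstab : Stabilises S 𝓢) {g : Submodule F V ≃o Submodule F V} (hg : g ∈ S)
    {μ : F ≃+* F} {A : V ≃+ V}
    (hμ : ∀ (a : F) (v : V), A (a • v) = μ a • A v)
    (hA : ∀ X : Submodule F V, (g X : Set V) = A '' (X : Set V)) {l : Submodule F V}
    (hl : l ∈ 𝓢) {x w : V} (hw : w ≠ 0) (hxl : x ∈ l) (hwl : w ∈ l)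
    (hxw : g (Submodule.span F {x}) = Submodule.span F {w}) :
    (∀ m ∈ 𝓢, ∀ v ∈ m, A v ∈ m) ∧ A x ∈ Submodule.span F {w} := by
  have hgl : g l = l := hsp.eq_of_point_le (hstab g hg l hl) hl (isPoint_span hw)
    (hxw ▸ g.monotone ((Submodule.span_singleton_le_iff_mem _ _).2 hxl))
    ((Submodule.span_singleton_le_iff_mem _ _).2 hwl)
  refine ⟨fun m hm v hv => ?_, ?_⟩
  · rw [← hS.apply_eq_of_mem_spread hsp hstab hg hl hm hgl]
    exact (apply_mem_iff_of_coe_eq_image hA).2 hv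
  · rw [← hxw, apply_span_singleton hμ hA]
    exact Submodule.mem_span_singleton_self _

variable [Finite F] [CharP F 2] [FiniteDimensional F V]
  {O : Set (Submodule F V)} {Q : V → F} {B : V →ₗ[F] V →ₗ[F] F}

/-- Every line off the spread is mapped to a tangent line by some element of `S`. -/
theorem exists_isTangentLine_apply (hS : IsSingerCycle S)
    (hsp : IsLineSpread 𝓢) (hstab : Stabilises S 𝓢) (h : IsEllipticForm O Q B)
    (htan : ∀ l ∈ 𝓢, IsTangentLine O l) {l : Submodule F V} (hl : IsLine l) (hlS : l ∉ 𝓢) :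
    ∃ g ∈ S, IsTangentLine O (g l) := by
  have hB : ∀ l ∈ 𝓢, ∀ x ∈ l, ∀ y ∈ l, B x y = 0 := fun l hl =>
    (h.isTangentLine_iff (hsp.1 l hl)).1 (htan l hl)
  obtain ⟨x, hx⟩ : ∃ x : V, x ≠ 0 := hl.exists_ne_zero.imp fun _ => And.right
  obtain ⟨k, hk, hxk⟩ := hsp.exists_mem hx
  obtain ⟨y, hyk, hy⟩ := (hsp.1 k hk).exists_notMem_span x
  have hy0 : y ≠ 0 := fun h0 => hy (h0 ▸ Submodule.zero_mem _)
  -- Two distinct points of one spread line yield a nontrivial `g` fixing the spread linewise, which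
  -- plays the role of `A`.
  obtain ⟨g, hg, hgx⟩ := hS.exists_apply_eq (isPoint_span (F := F) hx) (isPoint_span (F := F) hy0)
  have hg1 : g ≠ 1 := by
    rintro rfl
    have h1 : Submodule.span F {x} = Submodule.span F {y} := hgx
    exact hy (h1 ▸ Submodule.mem_span_singleton_self y)
  obtain ⟨μ, A, hμ, hA⟩ := hS.1 g hg
  obtain ⟨hfix, -⟩ := hS.apply_eq_of_mem hsp hstab hg hμ hA hk hy0 hxk hyk hgx
  obtain ⟨u, w, hu, hw, ⟨m, hm, hum, hwm⟩, hiso⟩ := h.exists_isotropic_image hsp hB hfix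
    (fun v hv => hS.apply_notMem_span hg hg1 hμ hA hv) hl hlS
  obtain ⟨f, hf, hfuw⟩ := hS.exists_apply_eq (isPoint_span (F := F) hu) (isPoint_span (F := F) hw)
  obtain ⟨ν, C, hν, hC⟩ := hS.1 f hf
  obtain ⟨hCfix, hCu⟩ := hS.apply_eq_of_mem hsp hstab hf hν hC hm hw hum hwm hfuw
  refine ⟨f, hf, (h.isTangentLine_iff ((hS.1 f hf).isLine_iff.2 hl)).2 ?_⟩
  intro v hv z hz
  obtain ⟨v, rfl⟩ := C.surjective v
  obtain ⟨z, rfl⟩ := C.surjective z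
  exact hiso ν C hν hCfix hCu v ((apply_mem_iff_of_coe_eq_image hC).1 hv) z
    ((apply_mem_iff_of_coe_eq_image hC).1 hz)

/-- A tangent line that is mapped to a tangent line by a nontrivial element of `S` fixing all
lines of the spread belongs to the spread. -/
theorem mem_spread_of_isTangentLine_apply (hS : IsSingerCycle S) (hV : Module.finrank F V = 4)
    (hsp : IsLineSpread 𝓢) (h : IsEllipticForm O Q B) (htan : ∀ l ∈ 𝓢, IsTangentLine O l)
    {g : Submodule F V ≃o Submodule F V} (hg : g ∈ S) (hg1 : g ≠ 1) (hfix : ∀ l ∈ 𝓢, g l = l)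
    {t : Submodule F V} (ht : IsTangentLine O t) (hgt : IsTangentLine O (g t)) : t ∈ 𝓢 := by
  obtain ⟨μ, A, hμ, hA⟩ := hS.1 g hg
  refine h.mem_spread_of_isotropic_image hV hsp
    (fun l hl => (h.isTangentLine_iff (hsp.1 l hl)).1 (htan l hl)) hμ (fun l hl v hv => ?_)
    (fun v hv => hS.apply_notMem_span hg hg1 hμ hA hv) ht.1 ((h.isTangentLine_iff ht.1).1 ht)
    (fun x hx y hy => (h.isTangentLine_iff hgt.1).1 hgt _
      ((apply_mem_iff_of_coe_eq_image hA).2 hx) _ ((apply_mem_iff_of_coe_eq_image hA).2 hy))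
  rw [← hfix l hl]
  exact (apply_mem_iff_of_coe_eq_image hA).2 hv

theorem isStarterSet_tangentLines (hS : IsSingerCycle S) (hV : Module.finrank F V = 4)
    (hsp : IsLineSpread 𝓢) (hstab : Stabilises S 𝓢)
    {S₂ : Subgroup (Submodule F V ≃o Submodule F V)} (hS₂ : S₂ ≤ S)
    (h : IsEllipticForm O Q B) (htan : ∀ l ∈ 𝓢, IsTangentLine O l)
    (hreg : ActsRegularlyOn S₂ O) {P : Submodule F V} (hP : P ∈ O) :
    IsStarterSet S P {l | IsTangentLine O l ∧ P ≤ l} := by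
  have hO : ∀ R ∈ O, IsPoint R := fun R hR => ((h.mem_iff R).1 hR).1
  have htan₂ : ∀ g ∈ S₂, ∀ l, IsTangentLine O l → IsTangentLine O (g l) := fun g hg l hl =>
    hl.apply (hS.1 g (hS₂ hg)) (hreg.apply_mem_iff hg)
  refine ⟨fun l hl => ⟨hl.1.1, hl.2⟩, ?_, fun l hl => ?_⟩
  · rintro t ⟨ht, hPt⟩ t' ⟨ht', hPt'⟩ hne g hg hgt
    obtain ⟨g₂, hg₂, g₁, hg₁, rfl, hfix⟩ :=
      hS.exists_mul_fixing_spread hsp hstab hS₂ hO htan hreg hP hg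
    -- If `g₁ = 1`, then `g` preserves `O` and hence fixes the tangency point `P`, so it is trivial.
    -- Otherwise `t` and `g₁ t` are both tangent, so `t`, and with it `t'`, is the spread line
    -- through `P`.
    by_cases h1 : g₁ = 1
    · subst h1
      rw [mul_one] at hgt
      have hP2 : g₂ P = P := ht'.2.unique
        ⟨(hreg.apply_mem_iff hg₂ P).2 hP, hgt ▸ g₂.monotone hPt⟩ ⟨hP, hPt'⟩
      have : g₂ = 1 := hS.eq_one_of_apply_eq (hS₂ hg₂) (hO P hP) hP2
      subst this
      exact hne hgt
    · have hg₁t : g₁ t = g₂⁻¹ t' := by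
        rw [← hgt]
        exact (g₂.symm_apply_apply (g₁ t)).symm
      have htS : t ∈ 𝓢 := hS.mem_spread_of_isTangentLine_apply hV hsp h htan hg₁ h1 hfix ht
        (hg₁t ▸ htan₂ _ (S₂.inv_mem hg₂) _ ht')
      exact hne (hsp.eq_of_point_le htS (hgt ▸ hstab _ hg t htS) (hO P hP) hPt hPt')
  · by_cases hlS : l ∈ 𝓢
    · obtain ⟨m, ⟨hm, hPm⟩, -⟩ := hsp.2.2 P (hO P hP)
      obtain ⟨g, hg, hgm⟩ := hS.exists_apply_eq_of_mem_spread hsp hstab hm hlS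
      exact ⟨m, ⟨htan m hm, hPm⟩, g, hg, hgm⟩
    · obtain ⟨f, hf, hfl⟩ := hS.exists_isTangentLine_apply hsp hstab h htan hl hlS
      obtain ⟨R, ⟨hR, hRl⟩, -⟩ := hfl.2
      -- Once `l` has been made tangent, `S₂` moves its tangency point to `P` and keeps it tangent.
      obtain ⟨g₂, ⟨hg₂, hRP⟩, -⟩ := hreg.2 R hR P hP
      refine ⟨g₂ (f l), ⟨htan₂ g₂ hg₂ _ hfl, hRP ▸ g₂.monotone hRl⟩, (g₂ * f)⁻¹,
        S.inv_mem (S.mul_mem (hS₂ hg₂) hf), ?_⟩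
      exact (g₂ * f).symm_apply_apply l

end IsSingerCycle

end Main

end ProjGeom

theorem mainTheorem1 {F : Type*} [Field F] [Fintype F] (q e : ℕ) (hq : q = 2 ^ e)
    (hF : Fintype.card F = q)
    (S : Subgroup (Submodule F (Fin 4 → F) ≃o Submodule F (Fin 4 → F)))
    (hS : ProjGeom.IsSingerCycle S)
    (𝓢 : Set (Submodule F (Fin 4 → F))) (h𝓢 : ProjGeom.IsRegularLineSpread 𝓢)
    (hstab : ProjGeom.Stabilises S 𝓢)
    (S₂ : Subgroup (Submodule F (Fin 4 → F) ≃o Submodule F (Fin 4 → F)))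
    (hS₂ : S₂ ≤ S) (hcard : Nat.card S₂ = q ^ 2 + 1)
    (O : Set (Submodule F (Fin 4 → F))) (hO : ProjGeom.IsEllipticQuadric O)
    (htan : ∀ l ∈ 𝓢, ProjGeom.IsTangentLine O l)
    (hreg : ProjGeom.ActsRegularlyOn S₂ O)
    (P : Submodule F (Fin 4 → F)) (hP : P ∈ O) :
    {l | ProjGeom.IsTangentLine O l ∧ P ≤ l}.ncard = q + 1 ∧
      ProjGeom.IsStarterSet S P {l | ProjGeom.IsTangentLine O l ∧ P ≤ l} := by
  have : Fact (Nat.Prime 2) := ⟨Nat.prime_two⟩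
  have : CharP F 2 := charP_of_card_eq_prime_pow (f := e) (hF.trans hq)
  obtain ⟨Q, B, h⟩ := hO.exists_isEllipticForm
  have hV : Module.finrank F (Fin 4 → F) = 4 := Module.finrank_fin_fun F
  refine ⟨?_, hS.isStarterSet_tangentLines hV h𝓢.1 hstab hS₂ h htan hreg hP⟩
  rw [h.ncard_tangentLines hV hP, Nat.card_eq_fintype_card, hF]
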